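/- **Setting.** Let $H=\mathsf H_3(\mathbb Z)$ be the set of triples $(x,(y,z))\in\mathbb Z\times\mathbb Z^2$ with product $(x,(y,z))(a,(b,c))=(x+a,(y+b,z+c+xb))$, with generators $\mathsf x=(1,(0,0))$, $\mathsf y=(0,(1,0))$, $\mathsf z=(0,(0,1))$. For a finite set $\mathcal A$, a pattern is a map $p:F\to\mathcal A$ with $F\subset H$ finite; it occurs in $\omega\in\mathcal A^H$ if there is $g\in H$ with $\omega(hg)=p(h)$ for all $h\in F$. An $H$-SFT is the set of all $\omega\in\mathcal A^H$ in which no pattern of some fixed finite family occurs. **Robinson tiles.** $\mathcal A_{\rm Rob}$ consists of the 56 unit squares obtained by rotating the following 14 tiles by multiples of $90^\circ$. Black arrows sit in the middle of an edge, coloured arrows off the middle. *Cross:* black arrows point out through all four edges; coloured arrows point out through the top edge, left of its middle, and through the right edge, below its middle. *Six arms:* the black main arrow enters at the top and leaves at the bottom, and further black arrows enter from the left and the right; in addition there is either no coloured arrow parallel to the main arrow, or one running from top to bottom on its left, or one on its right; and either no further coloured arrows, or two of them, entering through the left and the right edge below the middle. Each of these 7 tiles comes with two choices of a parity digit on each edge,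 written on the half-edges without coloured arrow: all digits are $0$; or the cross has all digits $1$, respectively an arm has digits $1$ on the left and right and digits $2$ at the top and bottom. Two tiles may be adjacent if across their common edge the arrows of each type match head to tail (at the same place of the edge) and the two parity digits sum to $2$. A Robinson tiling is a map $\rho:\mathbb Z^2\to\mathcal A_{\rm Rob}$ in which any horizontally or vertically adjacent tiles may be adjacent. Its level-$0$ supertiles are the crosses with digits $1$; a level-$(i+1)$ supertile centered at $c$ consists of a cross at $c$ and level-$i$ supertiles centered at the four sites $c+(\pm2^i,\pm2^i)$ whose central crosses emit their coloured arrows towards each other, along the square with these four corners. **Alphabet.** Let $\mathcal A_{\rm Bin}=\{0,1,\mathbf 0,\mathbf 1\}$ (plain and bold digits), let $\mathcal A_{\rm Seg}$ be the set of four squares carrying or not carrying a diagonal (from upper left to lower right) and a vertical "forward" segment, $\mathcal A_{\rm Count}=\mathcal A_{\rm Bin}\times\mathcal A_{\rm Seg}$ and $\mathcal A=\mathcal A_{\rm Rob}\sqcup\mathcal A_{\rm Count}$. A counter symbol at $h$ is written $(b_h,s_h)$. **The shift space.** $\Omega\subseteq\mathcal A^H$ is the set of all $\omega$ such that for all $h\in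 H$: 1. $\omega(h),\omega(\mathsf yh),\omega(\mathsf zh)$ lie all in $\mathcal A_{\rm Rob}$ or all in $\mathcal A_{\rm Count}$; if they lie in $\mathcal A_{\rm Rob}$, then $\omega(\mathsf yh)$ may be the right neighbour, and $\omega(\mathsf zh)$ the upper neighbour, of the tile $\omega(h)$. 2. If $s_h$ has a diagonal segment, so do the counter symbols at $\mathsf z\mathsf y^{-1}h$ and $\mathsf z^{-1}\mathsf yh$; if $s_h$ has a forward segment, so do the counter symbols at $\mathsf zh$ and $\mathsf z^{-1}h$. 3. $\omega(h)\in\mathcal A_{\rm Rob}$ if and only if $\omega(\mathsf xh)\in\mathcal A_{\rm Count}$. If $\omega(h)\in\mathcal A_{\rm Rob}$, then $b_{\mathsf xh}$ and $b_{\mathsf x^{-1}h}$ are both bold if $\omega(h)$ is a cross, and both plain otherwise; if $\omega(h)\in\mathcal A_{\rm Count}$, then $\omega(\mathsf xh)$ and $\omega(\mathsf x^{-1}h)$ are both crosses if $b_h$ is bold, and both non-crosses otherwise. 4. If $b_h$ is plain and $b_{\mathsf zh}$ is bold, then $b_{\mathsf x^2h}\ne b_h$. If $b_{\mathsf zh}$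 is plain, then $b_{\mathsf x^2\mathsf zh}$ is plain, $b_{\mathsf x^2h}$ is bold exactly if $b_h$ is, and $b_{\mathsf x^2h}$ has the same numerical value as $b_h$, except that it has the other one if $b_{\mathsf zh}=1$ and $b_{\mathsf x^2\mathsf zh}=0$. 5. If $b_h$ is bold, then $s_h$ carries both segments if $b_h=\mathbf 1$ and $b_{\mathsf x^2h}=\mathbf 0$, and $s_h$ is blank otherwise. **Proposition.** $\Omega$ is an $H$-SFT, and it is non-empty. More explicitly, there is a Robinson tiling $\rho$ whose level-$i$ supertiles are, for every $i\ge0$, centered exactly at the sites $(2^i+2^{i+1}\mathbb Z)\times(2^i+2^{i+1}\mathbb Z)$ and whose crosses are exactly at $$C=\{(0,0)\}\cup\bigcup_{i\ge1}(2^{i-1}+2^i\mathbb Z)\times(2^{i-1}+2^i\mathbb Z),$$ and there is $\omega\in\Omega$ with the following properties, for all $k,y,z\in\mathbb Z$, where $B=\{(0,0)\}\cup\bigcup_{i\ge1}(2^{i-1}+2^i\mathbb Z)\times2^i\mathbb Z$: - $\omega(2k,(y,z))=\rho(y,z)$. - $\omega(2k+1,(y,z))$ is a counter symbol. Its digit is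 bold if and only if $(y,z)\in B$. It has a forward segment if and only if $k=-1$ and $y=0$, or there is $i\ge1$ with $2^{2^i}\mid k+1$ and $y\in2^{i-1}+2^i\mathbb Z$. It has a diagonal segment if and only if $k=-1$ and $y+z=0$, or there is $i\ge1$ with $2^{2^i}\mid k+1$ and $y+z\in2^{i-1}+2^i\mathbb Z$. If it has a forward segment, its digit is $1$ or $\mathbf 1$. - If $i\ge1$, $y\in2^{i-1}+2^i\mathbb Z$ and $z\in2^i\mathbb Z$, then the $2^i$ digits at the sites $(2k+1,(y,z+t))$, $0\le t<2^i$, the most significant one at $t=0$, form the binary expansion of $k\bmod 2^{2^i}$. - For $n\ge0$, the digit at $(2k+1,(0,-1-n))$ has the value $\lfloor k/2^n\rfloor\bmod 2$, and the digit at $(2k+1,(0,n))$ has the value $0$ if $k\ge0$ and $1$ if $k<0$. - In particular all counters overflow simultaneously from the layer $x=-1$ to the layer $x=1$: $\omega(-1,(y,z))$ is a digit $1$ or $\mathbf 1$ with both segments, and $\omega(1,(y,z))$ is a digit $0$ or $\mathbf 0$ with a blank square, bold exactly for $(y,z)\in B$. -/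

import Mathlib

namespace HeisSFT

/-! ### Subshifts of finite type on a group

Patterns are translated from the right, as the local rules below compare the symbols at `h`
and at `s * h`. (The definitions of Mathlib translate from the left.) -/

/-- A pattern: an assignment of symbols to the elements of a finite support. -/
structure Pattern (G A : Type*) where
  supp : Finset G
  val : supp → A

/-- `p` occurs in the configuration `ω` if `p` is the restriction of a right shift of `ω`. -/
def Pattern.OccursIn {G A : Type*} [Group G] (p : Pattern G A) (ω : G → A) : Prop :=
  ∃ g : G, ∀ h : p.supp, ω ((h : G) * g) = p.val h

/-- The set of configurations in which no pattern of the family `F` occurs. -/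
def avoiding {G A : Type*} [Group G] (F : Set (Pattern G A)) : Set (G → A) :=
  {ω | ∀ p ∈ F, ¬ p.OccursIn ω}

/-- Shifts of finite type over the finite alphabet `A`: finitely many forbidden patterns. -/
def IsSFT {G A : Type*} [Group G] [Finite A] (X : Set (G → A)) : Prop :=
  ∃ F : Set (Pattern G A), F.Finite ∧ X = avoiding F

/-! ### The discrete Heisenberg group -/

/-- The element `(x, (y, z))` of `ℤ² ⋊ ℤ`, i.e. the matrix `[1, x, z; 0, 1, y; 0, 0, 1]`. -/
@[ext] structure Heis where
  x : ℤ
  y : ℤ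
  z : ℤ

namespace Heis

instance : Mul Heis := ⟨fun g h => ⟨g.x + h.x, g.y + h.y, g.z + h.z + g.x * h.y⟩⟩
instance : One Heis := ⟨⟨0, 0, 0⟩⟩
instance : Inv Heis := ⟨fun g => ⟨-g.x, -g.y, -g.z + g.x * g.y⟩⟩

@[simp] theorem mul_x (g h : Heis) : (g * h).x = g.x + h.x := rfl
@[simp] theorem mul_y (g h : Heis) : (g * h).y = g.y + h.y := rfl
@[simp] theorem mul_z (g h : Heis) : (g * h).z = g.z + h.z + g.x * h.y := rfl
@[simp] theorem one_x : (1 : Heis).x = 0 := rfl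
@[simp] theorem one_y : (1 : Heis).y = 0 := rfl
@[simp] theorem one_z : (1 : Heis).z = 0 := rfl
@[simp] theorem inv_x (g : Heis) : (g⁻¹).x = -g.x := rfl
@[simp] theorem inv_y (g : Heis) : (g⁻¹).y = -g.y := rfl
@[simp] theorem inv_z (g : Heis) : (g⁻¹).z = -g.z + g.x * g.y := rfl

instance : Group Heis :=
  Group.ofLeftAxioms
    (fun a b c => by ext <;> simp <;> ring)
    (fun a => by ext <;> simp)
    (fun a => by ext <;> simp)

/-- The generator `x`. -/
def gx : Heis := ⟨1, 0, 0⟩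
/-- The generator `y`. -/
def gy : Heis := ⟨0, 1, 0⟩
/-- The generator `z`. -/
def gz : Heis := ⟨0, 0, 1⟩

end Heis

/-! ### Robinson tiles -/

/-- The two off-centre positions on an edge of a tile, as seen from the centre of the tile
when looking outward across that edge. -/
inductive Hand
  | left
  | right
  deriving DecidableEq

instance : Fintype Hand := ⟨{.left, .right}, fun s => by cases s <;> simp⟩

def Hand.flip : Hand → Hand
  | .left => .right
  | .right => .left

/-- The decoration of one edge of a tile: whether the (centred) black arrow points outward;
the coloured arrow, if any, with its position and whether it points outward; the parity digit,
which is written on the half or halves of the edge not carrying a coloured arrow. -/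
structure Edge where
  blackOut : Bool
  coloured : Option (Hand × Bool)
  digit : ℕ
  deriving DecidableEq

/-- Two edge decorations may face each other: the arrows of each type match head to tail, at the
same place of the common edge (which two tiles facing each other see with opposite hands), and
the parity digits sum to `2`. -/
def Edge.Fits (e f : Edge) : Prop :=
  e.blackOut ≠ f.blackOut ∧
  f.coloured = e.coloured.map (fun c => (c.1.flip, !c.2)) ∧
  e.digit + f.digit = 2

/-- The seven arrow designs. `arm p t` has its black main arrow running from top to bottom and
two further black arrows coming in from left and right. If `p = some s`, a coloured arrow runs
parallel to the main arrow, on its left or right side in the picture (`s` is the side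
at which it enters through the top edge). If `t` is true, two coloured arrows enter through the
left and the right edge, below the black ones, i.e. towards the tip of the main arrow. The cross
has black arrows leaving through all edges and two coloured arrows leaving through the right edge
(below the black arrow) and the top edge (to the left of the black arrow). -/
inductive Shape
  | cross
  | arm (parallel : Option Hand) (transverse : Bool)
  deriving DecidableEq, Fintype

/-- The edges of the unrotated tiles; `0, 1, 2, 3` are the right, top, left and bottom edge.
If `odd` is false, all parity digits are `0`; otherwise the cross has digits `1`, and arms have
digits `1` on the left and right and digits `2` at the top and the bottom. -/
def baseEdge (odd : Bool) : Shape → Fin 4 → Edge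
  | .cross, 0 => ⟨true, some (.right, true), if odd then 1 else 0⟩
  | .cross, 1 => ⟨true, some (.left, true), if odd then 1 else 0⟩
  | .cross, 2 => ⟨true, none, if odd then 1 else 0⟩
  | .cross, 3 => ⟨true, none, if odd then 1 else 0⟩
  | .arm _ t, 0 => ⟨false, if t then some (.right, false) else none, if odd then 1 else 0⟩
  | .arm p _, 1 => ⟨false, p.map (fun s => (s, false)), if odd then 2 else 0⟩
  | .arm _ t, 2 => ⟨false, if t then some (.left, false) else none, if odd then 1 else 0⟩
  | .arm p _, 3 => ⟨true, p.map (fun s => (s.flip, true)), if odd then 2 else 0⟩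

/-- The 56 Robinson tiles: 14 tiles, rotated counterclockwise by `rot` quarter turns. -/
structure RobTile where
  shape : Shape
  odd : Bool
  rot : Fin 4
  deriving DecidableEq, Fintype

def RobTile.edge (t : RobTile) (d : Fin 4) : Edge := baseEdge t.odd t.shape (d - t.rot)

/-- `t` may be placed immediately to the right of `s`. -/
def RobTile.FitsRight (s t : RobTile) : Prop := (s.edge 0).Fits (t.edge 2)

/-- `t` may be placed immediately above `s`. -/
def RobTile.FitsAbove (s t : RobTile) : Prop := (s.edge 1).Fits (t.edge 3)

/-- The `ℤ²`-Robinson tilings. -/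
def OmegaRob : Set (ℤ × ℤ → RobTile) :=
  {ρ | ∀ y z : ℤ, (ρ (y, z)).FitsRight (ρ (y + 1, z)) ∧ (ρ (y, z)).FitsAbove (ρ (y, z + 1))}

/-- A level-`i` supertile of the tiling `ρ` is centred at `(y, z)`. Level-0 supertiles are the
crosses with parity digits `1`. A level-`(i+1)` supertile has a central cross and is composed of
four level-`i` supertiles, whose central crosses are the corners of a square contour of coloured
arrows, i.e. emit their coloured arrows towards each other. -/
def IsSupertile (ρ : ℤ × ℤ → RobTile) : ℕ → ℤ → ℤ → Prop
  | 0, y, z => (ρ (y, z)).shape = .cross ∧ (ρ (y, z)).odd = true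
  | i + 1, y, z => (ρ (y, z)).shape = .cross ∧
      (IsSupertile ρ i (y - 2 ^ i) (z - 2 ^ i) ∧ (ρ (y - 2 ^ i, z - 2 ^ i)).rot = 0) ∧
      (IsSupertile ρ i (y + 2 ^ i) (z - 2 ^ i) ∧ (ρ (y + 2 ^ i, z - 2 ^ i)).rot = 1) ∧
      (IsSupertile ρ i (y + 2 ^ i) (z + 2 ^ i) ∧ (ρ (y + 2 ^ i, z + 2 ^ i)).rot = 2) ∧
      (IsSupertile ρ i (y - 2 ^ i) (z + 2 ^ i) ∧ (ρ (y - 2 ^ i, z + 2 ^ i)).rot = 3)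

/-! ### The alphabet -/

/-- A binary digit, possibly in bold face. -/
structure Bin where
  bold : Bool
  bit : Bool
  deriving DecidableEq, Fintype

/-- A square carrying a northwest-southeast diagonal and/or a vertical forward segment. -/
structure Seg where
  diagonal : Bool
  forward : Bool
  deriving DecidableEq, Fintype

def Seg.blank : Seg := ⟨false, false⟩
def Seg.both : Seg := ⟨true, true⟩

/-- Counter symbols. -/
abbrev Count : Type := Bin × Seg

/-- Robinson tiles and counter symbols. -/
abbrev Alphabet : Type := RobTile ⊕ Count

def IsRob : Alphabet → Prop
  | .inl _ => True
  | .inr _ => False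

def IsCount : Alphabet → Prop
  | .inl _ => False
  | .inr _ => True

def IsCross : Alphabet → Prop
  | .inl t => t.shape = .cross
  | .inr _ => False

def IsBold : Alphabet → Prop
  | .inl _ => False
  | .inr c => c.1.bold = true

def HasDiagonal : Alphabet → Prop
  | .inl _ => False
  | .inr c => c.2.diagonal = true

def HasForward : Alphabet → Prop
  | .inl _ => False
  | .inr c => c.2.forward = true

/-- The sixteen patterns admitted by the local addition rule when the digit `r` at `z h` is not
bold: here `b, b'` are the digits at `h` and `x² h`, and `r, r'` those at `z h` and `x² z h`.
A carry passes from `z h` to `h` exactly if the digit at `z h` changes from `1` to `0`. -/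
def AddPattern (b r b' r' : Bin) : Prop :=
  r.bold = false ∧ r'.bold = false ∧ b'.bold = b.bold ∧
  b'.bit = xor b.bit (r.bit && !r'.bit)

/-! ### The shift space -/

open Heis in
/-- The local rules. -/
structure IsValid (ω : Heis → Alphabet) : Prop where
  /-- Cosets of `⟨y, z⟩` are filled by Robinson tiles only or by counter symbols only. -/
  rob_coset : ∀ h, IsRob (ω h) → IsRob (ω (gy * h)) ∧ IsRob (ω (gz * h))
  count_coset : ∀ h, IsCount (ω h) → IsCount (ω (gy * h)) ∧ IsCount (ω (gz * h))
  /-- Robinson rules. -/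
  rob_right : ∀ h s t, ω h = .inl s → ω (gy * h) = .inl t → s.FitsRight t
  rob_above : ∀ h s t, ω h = .inl s → ω (gz * h) = .inl t → s.FitsAbove t
  /-- Segments have to continue. -/
  diagonal : ∀ h, HasDiagonal (ω h) →
    HasDiagonal (ω (gz * gy⁻¹ * h)) ∧ HasDiagonal (ω (gz⁻¹ * gy * h))
  forward : ∀ h, HasForward (ω h) → HasForward (ω (gz * h)) ∧ HasForward (ω (gz⁻¹ * h))
  /-- The two kinds of cosets alternate. -/
  alternate_rob : ∀ h, IsRob (ω h) → IsCount (ω (gx * h))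
  alternate_count : ∀ h, IsCount (ω h) → IsRob (ω (gx * h))
  /-- Propagation of crosses. -/
  cross_rob : ∀ h, IsRob (ω h) →
    (IsBold (ω (gx * h)) ↔ IsCross (ω h)) ∧ (IsBold (ω (gx⁻¹ * h)) ↔ IsCross (ω h))
  cross_count : ∀ h, IsCount (ω h) →
    (IsCross (ω (gx * h)) ↔ IsBold (ω h)) ∧ (IsCross (ω (gx⁻¹ * h)) ↔ IsBold (ω h))
  /-- The least significant bit of a counter changes in every step. -/
  least_bit : ∀ h (c r c' : Count), ω h = .inr c → ω (gz * h) = .inr r → ω (gx ^ 2 * h) = .inr c' →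
    c.1.bold = false → r.1.bold = true → c'.1 ≠ c.1
  /-- Addition with carry. -/
  add : ∀ h (c r c' r' : Count), ω h = .inr c → ω (gz * h) = .inr r →
    ω (gx ^ 2 * h) = .inr c' → ω (gx ^ 2 * gz * h) = .inr r' →
    r.1.bold = false → AddPattern c.1 r.1 c'.1 r'.1
  /-- A bold digit carries both segments if it is about to change from `1` to `0` (total overflow
  of its counter), and no segment otherwise. -/
  overflow : ∀ h (c c' : Count), ω h = .inr c → ω (gx ^ 2 * h) = .inr c' → c.1.bold = true →
    c.2 = if c.1 = ⟨true, true⟩ ∧ c'.1 = ⟨true, false⟩ then Seg.both else Seg.blank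

/-- The shift space `Ω`. -/
def Omega : Set (Heis → Alphabet) := {ω | IsValid ω}

/-! ### Description of a particular configuration -/

/-- The set `{(0, 0)} ∪ ⋃ᵢ (2ⁱ + 2ⁱ⁺¹ℤ) × (2ⁱ + 2ⁱ⁺¹ℤ)`. -/
def crossSites : Set (ℤ × ℤ) :=
  {p | p = (0, 0) ∨ ∃ i : ℕ, p.1 ≡ 2 ^ i [ZMOD 2 ^ (i + 1)] ∧ p.2 ≡ 2 ^ i [ZMOD 2 ^ (i + 1)]}

/-- The set `{(0, 0)} ∪ ⋃ᵢ (2ⁱ + 2ⁱ⁺¹ℤ) × 2ⁱ⁺¹ℤ`. -/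
def boldSites : Set (ℤ × ℤ) :=
  {p | p = (0, 0) ∨ ∃ i : ℕ, p.1 ≡ 2 ^ i [ZMOD 2 ^ (i + 1)] ∧ p.2 ≡ 0 [ZMOD 2 ^ (i + 1)]}

/-- The numerical value of the digit of a counter symbol. -/
def digit : Alphabet → ℤ
  | .inl _ => 0
  | .inr c => if c.1.bit then 1 else 0

/-- The binary number of width `n` whose digits are read at the sites `h, z h, …, zⁿ⁻¹ h`,
the most significant one being at `h`. -/
def counterValue (ω : Heis → Alphabet) (n : ℕ) (h : Heis) : ℤ :=
  ∑ t ∈ Finset.range n, digit (ω (Heis.gz ^ t * h)) * 2 ^ (n - 1 - t)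

end HeisSFT

namespace HeisSFT

/-! ### Binary digits and 2-adic levels of integers -/

/-! The first claim is locality: each rule compares a site with finitely many fixed left
displacements, so membership in `Omega` is a condition on all translates of one finite window
(`isValid_iff`, `IsValidAtOne.congr`, `isSFT_of_window`).

For the second, explicit 2-adic formulas give the tiling and the counters. On a row or column `a ≠
0` with `lev a = i`, the arrows are read from the bits `i` and `i + 1` of the position: black arrows
leave the positions of level `i` and meet at the multiples of `2^(i+1)`; coloured arrows run where
the two bits differ. On the axes, black arrows leave the origin. Each edge decoration is thus a
function of a line and a position, and adjacent tiles match once every tile is shown to have the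
four prescribed edges (`robTile_edges`). Comparing the levels of `y` and `z` decides between
crosses, vertical arms and horizontal arms.

On layer `2k+1`, a column `y ≠ 0` is cut into blocks of length `2^(lev y + 1)`, each holding `k`
modulo 2 to the power of its length; column 0 holds the two's complement digits of `k` below the
origin and its sign from the origin upwards. Left multiplication by `gx` shears column `y` by `y`,
which exchanges cross sites and bold sites (`add_mem_boldSites_iff`, `sub_mem_boldSites_iff`). `gx ^
2` shears by `2y`, a multiple of the block length, so its only effect on the digits is to replace
`k` by `k + 1`, and the counter rules become binary addition (`bit_succ_add_one`).

Overflow of a column depends only on `k` and its level. At a bold site `(y, z)` the numbers `y` and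
`y + z` have the same level, so vertical and diagonal lines can be marked independently by the
overflow condition and still agree at the bold sites (`overflows_add_of_mem_boldSites`). For `k =
-1` the condition holds for every column. -/

/-- The `n`-th binary digit of an integer (in two's complement). -/
def bit (n : ℕ) (b : ℤ) : Bool := decide (b / 2 ^ n % 2 = 1)

theorem sub_one_ediv_of_dvd {b d : ℤ} (hd : 0 < d) (h : d ∣ b) : (b - 1) / d = b / d - 1 := by
  obtain ⟨q, rfl⟩ := h
  rw [Int.mul_ediv_cancel_left _ hd.ne']
  refine ((Int.ediv_emod_unique (r := d - 1) hd).2 ⟨by ring, by omega, by omega⟩).1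

theorem sub_one_ediv_of_not_dvd {b d : ℤ} (hd : 0 < d) (h : ¬ d ∣ b) : (b - 1) / d = b / d := by
  have h0 : b % d ≠ 0 := fun h' => h (Int.dvd_of_emod_eq_zero h')
  have h1 := Int.emod_nonneg b hd.ne'
  have h2 := Int.emod_lt_of_pos b hd
  have h3 := Int.emod_add_mul_ediv b d
  exact ((Int.ediv_emod_unique (r := b % d - 1) hd).2 ⟨by linarith, by omega, by omega⟩).1

theorem ediv_two_pow_succ (b : ℤ) (n : ℕ) : b / 2 ^ (n + 1) = b / 2 ^ n / 2 := by
  rw [pow_succ, Int.ediv_ediv_of_nonneg (by positivity)]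

theorem two_pow_succ_dvd_iff {b : ℤ} {n : ℕ} :
    (2 : ℤ) ^ (n + 1) ∣ b ↔ 2 ^ n ∣ b ∧ b / 2 ^ n % 2 = 0 := by
  have h0 : (2 : ℤ) ^ n ≠ 0 := by positivity
  constructor
  · rintro ⟨q, rfl⟩
    refine ⟨⟨2 * q, by ring⟩, ?_⟩
    rw [pow_succ, mul_assoc, Int.mul_ediv_cancel_left _ h0]
    omega
  · rintro ⟨⟨q, rfl⟩, h⟩
    rw [Int.mul_ediv_cancel_left _ h0] at h
    obtain ⟨r, rfl⟩ := Int.dvd_of_emod_eq_zero h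
    exact ⟨r, by ring⟩

/-- The borrow in `b - 1` reaches bit `n` exactly when all lower bits of `b` vanish. -/
theorem bit_sub_one_of_not_dvd {n : ℕ} {b : ℤ} (h : ¬ (2 : ℤ) ^ n ∣ b) :
    bit n (b - 1) = bit n b := by
  rw [bit, bit, sub_one_ediv_of_not_dvd (by positivity) h]

theorem bit_sub_one_of_dvd {n : ℕ} {b : ℤ} (h : (2 : ℤ) ^ n ∣ b) :
    bit n (b - 1) = !bit n b := by
  rw [bit, bit, sub_one_ediv_of_dvd (by positivity) h, ← decide_not, decide_eq_decide]
  omega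

theorem two_pow_succ_dvd_iff_bit {n : ℕ} {b : ℤ} :
    (2 : ℤ) ^ (n + 1) ∣ b ↔ 2 ^ n ∣ b ∧ bit n b = false := by
  rw [two_pow_succ_dvd_iff, bit, decide_eq_false_iff_not]
  constructor <;> rintro ⟨h, h'⟩ <;> exact ⟨h, by omega⟩

/-- The exponent of `2` in an integer. -/
noncomputable def lev (a : ℤ) : ℕ := multiplicity 2 a

theorem lev_spec {a : ℤ} (ha : a ≠ 0) : (2 : ℤ) ^ lev a ∣ a ∧ ¬ (2 : ℤ) ^ (lev a + 1) ∣ a := by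
  have h : FiniteMultiplicity 2 a := Int.finiteMultiplicity_iff.2 ⟨by decide, ha⟩
  exact ⟨pow_multiplicity_dvd _ _, h.not_pow_dvd_of_multiplicity_lt (Nat.lt_succ_self _)⟩

theorem lev_eq {a : ℤ} {i : ℕ} (h : (2 : ℤ) ^ i ∣ a) (h' : ¬ (2 : ℤ) ^ (i + 1) ∣ a) :
    a ≠ 0 ∧ lev a = i :=
  ⟨by rintro rfl; simp at h', multiplicity_eq_of_dvd_of_not_dvd h h'⟩

theorem two_pow_dvd_iff_le_lev {a : ℤ} (ha : a ≠ 0) {n : ℕ} : (2 : ℤ) ^ n ∣ a ↔ n ≤ lev a := by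
  obtain ⟨h, h'⟩ := lev_spec ha
  constructor
  · intro hn
    by_contra! hlt
    exact h' ((pow_dvd_pow 2 hlt).trans hn)
  · exact fun hn => (pow_dvd_pow 2 hn).trans h

theorem modEq_two_pow_iff {a : ℤ} {i : ℕ} :
    a ≡ 2 ^ i [ZMOD 2 ^ (i + 1)] ↔ a ≠ 0 ∧ lev a = i := by
  have h0 : (2 : ℤ) ^ i ≠ 0 := by positivity
  have key : a ≡ 2 ^ i [ZMOD 2 ^ (i + 1)] ↔ (2 : ℤ) ^ i ∣ a ∧ ¬ (2 : ℤ) ^ (i + 1) ∣ a := by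
    rw [two_pow_succ_dvd_iff, Int.modEq_comm, Int.modEq_iff_dvd]
    constructor
    · rintro ⟨q, hq⟩
      obtain rfl : a = 2 ^ i * (2 * q + 1) := by rw [pow_succ] at hq; linarith
      refine ⟨dvd_mul_right _ _, ?_⟩
      rw [Int.mul_ediv_cancel_left _ h0]
      omega
    · rintro ⟨⟨q, rfl⟩, h⟩
      rw [Int.mul_ediv_cancel_left _ h0] at h
      refine ⟨q / 2, ?_⟩
      have : q = 2 * (q / 2) + 1 := by
        simp only [dvd_mul_right, true_and] at h
        omega
      rw [pow_succ]
      linear_combination (2 : ℤ) ^ i * this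
  rw [key]
  constructor
  · exact fun h => lev_eq h.1 h.2
  · rintro ⟨ha, rfl⟩
    exact lev_spec ha

/-! ### A hierarchical Robinson tiling -/

/-- The black arrow on the edge between the `b`-th and the `(b+1)`-st site of line `a` points in
the increasing direction. -/
noncomputable def fwd (a b : ℤ) : Bool := if a = 0 then decide (0 ≤ b) else bit (lev a) b

/-- The binary digit of `b` whose disagreement with `fwd a b` indicates a coloured arrow. -/
noncomputable def nxt (a b : ℤ) : Bool := if a = 0 then false else bit (lev a + 1) b

/-- On which side of line `a` the coloured arrows run. -/
noncomputable def side (a : ℤ) : Bool := if a = 0 then false else bit (lev a + 1) a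

/-- The lowest set bit of `y` is bit `lev y`, so passing to `y - 1` flips it and keeps the next bit.
Hence black arrows leave on both sides and exactly one of them is accompanied by a coloured arrow.
-/
theorem fwd_nxt_of_level_eq {y z : ℤ} (h : (y = 0 ∧ z = 0) ∨ (y ≠ 0 ∧ z ≠ 0 ∧ lev y = lev z)) :
    fwd z y = true ∧ fwd z (y - 1) = false ∧ nxt z y = side y ∧ nxt z (y - 1) = side y := by
  rcases h with ⟨rfl, rfl⟩ | ⟨hy, hz, h⟩
  · simp [fwd, nxt, side]
  · obtain ⟨h1, h2⟩ := lev_spec hy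
    have h3 : bit (lev y) y = true := by
      rw [two_pow_succ_dvd_iff_bit] at h2
      simpa [h1] using h2
    simp [fwd, nxt, side, hy, hz, ← h, h3, bit_sub_one_of_dvd h1, bit_sub_one_of_not_dvd h2]

/-- Horizontal black arrows meet here and the vertical one passes through. Transverse coloured
arrows have to enter on the side of its tip. They occur only if `lev y = lev z + 1`, and then `side
z` and `fwd y z` are the same bit of `z`. -/
theorem fwd_nxt_of_dvd {y z : ℤ} (hz : z ≠ 0) (h : (2 : ℤ) ^ (lev z + 1) ∣ y) :
    fwd z y = false ∧ fwd z (y - 1) = true ∧ nxt z (y - 1) = (!nxt z y) ∧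
    (nxt z y = true → side z = fwd y z) ∧ fwd y (z - 1) = fwd y z ∧ nxt y (z - 1) = nxt y z := by
  obtain ⟨h1, h2⟩ := two_pow_succ_dvd_iff_bit.1 h
  have hx : nxt z (y - 1) = (!nxt z y) := by simp [nxt, hz, bit_sub_one_of_dvd h]
  refine ⟨by simp [fwd, hz, h2], by simp [fwd, hz, bit_sub_one_of_dvd h1, h2], hx, ?_⟩
  by_cases hy : y = 0
  · subst hy
    simp only [nxt, hz, if_false, fwd, if_true]
    refine ⟨by simp [bit], ?_, trivial⟩
    rw [decide_eq_decide]; omega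
  · have hlt : lev z + 1 ≤ lev y := (two_pow_dvd_iff_le_lev hy).1 h
    have n1 : ¬ (2 : ℤ) ^ lev y ∣ z := by rw [two_pow_dvd_iff_le_lev hz]; omega
    have n2 : ¬ (2 : ℤ) ^ (lev y + 1) ∣ z := by rw [two_pow_dvd_iff_le_lev hz]; omega
    simp only [nxt, hz, hy, if_false, fwd, side, bit_sub_one_of_not_dvd n1,
      bit_sub_one_of_not_dvd n2, and_self, and_true]
    intro h3
    -- A set bit at `lev z + 1` bounds `lev y` from above, leaving only `lev y = lev z + 1`.
    have : ¬ (2 : ℤ) ^ (lev z + 1 + 1) ∣ y := by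
      rw [two_pow_succ_dvd_iff_bit, h3]; simp
    rw [two_pow_dvd_iff_le_lev hy] at this
    rw [show lev y = lev z + 1 by omega]

theorem level_trichotomy (y z : ℤ) :
    ((y = 0 ∧ z = 0) ∨ (y ≠ 0 ∧ z ≠ 0 ∧ lev y = lev z)) ∨
    (z ≠ 0 ∧ (2 : ℤ) ^ (lev z + 1) ∣ y) ∨ (y ≠ 0 ∧ (2 : ℤ) ^ (lev y + 1) ∣ z) := by
  by_cases hy : y = 0
  · by_cases hz : z = 0
    · simp [hy, hz]
    · simp [hy, hz]
  · by_cases hz : z = 0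
    · simp [hy, hz]
    · rw [two_pow_dvd_iff_le_lev hy, two_pow_dvd_iff_le_lev hz]
      have := lt_trichotomy (lev y) (lev z)
      simp only [hy, hz, ne_eq, not_false_eq_true, true_and, false_and, false_or]
      omega

/-! ### Tiles realising the arrow data -/

/-- The rotation of a cross which emits its coloured arrows towards the decreasing first
coordinate iff `s`, and towards the decreasing second coordinate iff `t`. -/
def crossRot : Bool → Bool → Fin 4
  | false, false => 0
  | true, false => 1
  | true, true => 2
  | false, true => 3

/-- The decoration of an edge: black arrow outward iff `out`, the coloured arrow parallel to it. -/
def lineEdge (out col hand : Bool) (digit : ℕ) : Edge :=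
  ⟨out, if col then some (if hand then .right else .left, out) else none, digit⟩

/-- The parity digit on the edge of a tile in line `a` and at position `b` on this line. -/
def parityDigit (oa ob : Bool) : ℕ := if oa then 1 else if ob then 2 else 0

/-- The tile with prescribed black arrows to the right, left, top, bottom. -/
def tileOf (r l rn u d un sy sz oy oz : Bool) : RobTile :=
  if r = l then
    ⟨.arm (if r = rn then none else some (if sz = r then .right else .left)) un,
      oy || oz, if r then 1 else 3⟩
  else if u = d then
    ⟨.arm (if u = un then none else some (if sy = u then .left else .right)) rn,
      oy || oz, if u then 2 else 0⟩
  else ⟨.cross, oy || oz, crossRot sy sz⟩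

noncomputable def robTile (p : ℤ × ℤ) : RobTile :=
  tileOf (fwd p.2 p.1) (fwd p.2 (p.1 - 1)) (nxt p.2 p.1)
    (fwd p.1 p.2) (fwd p.1 (p.2 - 1)) (nxt p.1 p.2) (side p.1) (side p.2)
    (decide (p.1 % 2 = 1)) (decide (p.2 % 2 = 1))

/-- The four edges of a tile agree with prescribed data. -/
def EdgesAgree (t : RobTile) (r l rn ln u d un dn sy sz oy oz : Bool) : Prop :=
  t.edge 0 = lineEdge r (r ^^ rn) (!sz) (parityDigit oz oy) ∧
  t.edge 2 = lineEdge (!l) (l ^^ ln) sz (parityDigit oz oy) ∧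
  t.edge 1 = lineEdge u (u ^^ un) sy (parityDigit oy oz) ∧
  t.edge 3 = lineEdge (!d) (d ^^ dn) (!sy) (parityDigit oy oz)

instance (t : RobTile) (r l rn ln u d un dn sy sz oy oz : Bool) :
    Decidable (EdgesAgree t r l rn ln u d un dn sy sz oy oz) := by
  unfold EdgesAgree; infer_instance

theorem edgesAgree_cross (sy sz o : Bool) :
    EdgesAgree (tileOf true false sy true false sz sy sz o o)
      true false sy sy true false sz sz sy sz o o := by
  revert sy sz o; decide

theorem edgesAgree_vertical (rn u un sy sz oz : Bool) (h : rn = true → sz = u) :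
    EdgesAgree (tileOf false true rn u u un sy sz false oz)
      false true rn (!rn) u u un un sy sz false oz := by
  revert rn u un sy sz oz; decide

theorem edgesAgree_horizontal (r rn un sy sz oy : Bool) (h : un = true → sy = r) :
    EdgesAgree (tileOf r r rn false true un sy sz oy false)
      r r rn rn false true un (!un) sy sz oy false := by
  revert r rn un sy sz oy; decide

theorem even_of_two_pow_succ_dvd {a : ℤ} {n : ℕ} (h : (2 : ℤ) ^ (n + 1) ∣ a) : a % 2 = 0 :=
  Int.emod_eq_zero_of_dvd ((dvd_pow_self 2 (by omega)).trans h)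

theorem lev_eq_zero_iff {a : ℤ} (ha : a ≠ 0) : lev a = 0 ↔ a % 2 = 1 := by
  have := two_pow_dvd_iff_le_lev ha (n := 1)
  rw [pow_one] at this
  omega

theorem robTile_edges (y z : ℤ) :
    EdgesAgree (robTile (y, z)) (fwd z y) (fwd z (y - 1)) (nxt z y) (nxt z (y - 1))
      (fwd y z) (fwd y (z - 1)) (nxt y z) (nxt y (z - 1)) (side y) (side z)
      (decide (y % 2 = 1)) (decide (z % 2 = 1)) := by
  unfold robTile
  rcases level_trichotomy y z with h | ⟨hz, h⟩ | ⟨hy, h⟩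
  · obtain ⟨h1, h2, h3, h4⟩ := fwd_nxt_of_level_eq h
    have h' : (z = 0 ∧ y = 0) ∨ (z ≠ 0 ∧ y ≠ 0 ∧ lev z = lev y) := by tauto
    obtain ⟨h5, h6, h7, h8⟩ := fwd_nxt_of_level_eq h'
    -- Level 0 means odd, so equal levels give equal parities, as required by the uniform digits of
    -- a cross.
    have ho : decide (z % 2 = 1) = decide (y % 2 = 1) := by
      rcases h with ⟨rfl, rfl⟩ | ⟨hy, hz, h⟩
      · rfl
      · rw [decide_eq_decide, ← lev_eq_zero_iff hy, ← lev_eq_zero_iff hz, h]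
    simp only [h1, h2, h3, h4, h5, h6, h7, h8, ho]
    exact edgesAgree_cross _ _ _
  · obtain ⟨h1, h2, h3, h4, h5, h6⟩ := fwd_nxt_of_dvd hz h
    simp only [h1, h2, h3, h5, h6, even_of_two_pow_succ_dvd h]
    exact edgesAgree_vertical _ _ _ _ _ _ h4
  · obtain ⟨h1, h2, h3, h4, h5, h6⟩ := fwd_nxt_of_dvd hy h
    simp only [h1, h2, h3, h5, h6, even_of_two_pow_succ_dvd h]
    exact edgesAgree_horizontal _ _ _ _ _ _ h4

/-- Seen from the next site, direction and hand are reversed and the parity of the position changes: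
digits add as `1 + 1` on odd lines and as `0 + 2` on even ones. -/
theorem lineEdge_fits (f c s oa ob : Bool) :
    (lineEdge f c (!s) (parityDigit oa ob)).Fits (lineEdge (!f) c s (parityDigit oa (!ob))) := by
  unfold Edge.Fits
  revert f c s oa ob; decide

theorem lineEdge_fits' (f c s oa ob : Bool) :
    (lineEdge f c s (parityDigit oa ob)).Fits (lineEdge (!f) c (!s) (parityDigit oa (!ob))) := by
  simpa using lineEdge_fits f c (!s) oa ob

theorem decide_add_one_odd (a : ℤ) : decide ((a + 1) % 2 = 1) = !decide (a % 2 = 1) := by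
  rw [← decide_not, decide_eq_decide]; omega

theorem robTile_mem : robTile ∈ OmegaRob := by
  intro y z
  constructor
  · have h1 := (robTile_edges y z).1
    have h2 := (robTile_edges (y + 1) z).2.1
    rw [add_sub_cancel_right, decide_add_one_odd] at h2
    rw [RobTile.FitsRight, h1, h2]
    exact lineEdge_fits _ _ _ _ _
  · have h1 := (robTile_edges y z).2.2.1
    have h2 := (robTile_edges y (z + 1)).2.2.2
    rw [add_sub_cancel_right, decide_add_one_odd] at h2
    rw [RobTile.FitsAbove, h1, h2]
    exact lineEdge_fits' _ _ _ _ _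

/-! ### Crosses and supertiles of the tiling -/

theorem mem_crossSites_iff {y z : ℤ} :
    (y, z) ∈ crossSites ↔ (y = 0 ∧ z = 0) ∨ (y ≠ 0 ∧ z ≠ 0 ∧ lev y = lev z) := by
  simp only [crossSites, Set.mem_ofPred_eq, modEq_two_pow_iff, Prod.mk.injEq]
  refine or_congr Iff.rfl ⟨?_, ?_⟩
  · rintro ⟨i, ⟨hy, rfl⟩, hz, h⟩
    exact ⟨hy, hz, h.symm⟩
  · rintro ⟨hy, hz, h⟩
    exact ⟨lev y, ⟨hy, rfl⟩, hz, h.symm⟩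

theorem robTile_of_mem_crossSites {y z : ℤ} (h : (y, z) ∈ crossSites) :
    robTile (y, z) = ⟨.cross, decide (y % 2 = 1) || decide (z % 2 = 1),
      crossRot (side y) (side z)⟩ := by
  rw [mem_crossSites_iff] at h
  have h' : (z = 0 ∧ y = 0) ∨ (z ≠ 0 ∧ y ≠ 0 ∧ lev z = lev y) := by tauto
  obtain ⟨h1, h2, -⟩ := fwd_nxt_of_level_eq h
  obtain ⟨h3, h4, -⟩ := fwd_nxt_of_level_eq h'
  simp [robTile, tileOf, h1, h2, h3, h4]

theorem robTile_shape_eq_cross_iff (p : ℤ × ℤ) :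
    (robTile p).shape = .cross ↔ p ∈ crossSites := by
  obtain ⟨y, z⟩ := p
  refine ⟨fun hc => ?_, fun h => by rw [robTile_of_mem_crossSites h]⟩
  rcases level_trichotomy y z with h | ⟨hz, h⟩ | ⟨hy, h⟩
  · exact mem_crossSites_iff.2 h
  · obtain ⟨h1, h2, h3, h4, h5, h6⟩ := fwd_nxt_of_dvd hz h
    simp [robTile, tileOf, h1, h2, h5] at hc
  · obtain ⟨h1, h2, h3, h4, h5, h6⟩ := fwd_nxt_of_dvd hy h
    simp [robTile, tileOf, h5] at hc

/-- Writing `a = 2^i q` with `q` odd, bit `i + 1` of `a` distinguishes `q ≡ 1` from `q ≡ 3` modulo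
4. -/
theorem side_eq_iff {a : ℤ} {i : ℕ} (h : a ≠ 0 ∧ lev a = i) :
    side a = false ↔ a ≡ 2 ^ i [ZMOD 2 ^ (i + 2)] := by
  obtain ⟨ha, rfl⟩ := h
  obtain ⟨⟨q, hq⟩, h2⟩ := lev_spec ha
  have h0 : (2 : ℤ) ^ lev a ≠ 0 := by positivity
  have hd : a / 2 ^ lev a = q := Int.ediv_eq_of_eq_mul_right h0 hq
  have ho : q % 2 = 1 := by
    rw [two_pow_succ_dvd_iff, hd] at h2
    have : (2 : ℤ) ^ lev a ∣ a := ⟨q, hq⟩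
    simp only [this, true_and] at h2
    omega
  rw [side, if_neg ha, bit, ediv_two_pow_succ, hd, decide_eq_false_iff_not, Int.modEq_comm,
    Int.modEq_iff_dvd]
  have e : a - 2 ^ lev a = 2 ^ lev a * (q - 1) := by linear_combination hq
  rw [e, pow_add, mul_dvd_mul_iff_left h0]
  omega

theorem crossRot_eq_iff (s t s' t' : Bool) : crossRot s t = crossRot s' t' ↔ s = s' ∧ t = t' := by
  revert s t s' t'; decide

/-- Here `a = 2^i (4q + 2)`, so the two neighbours are `2^i (4q + 1)` and `2^i (4q + 3)`. -/
theorem side_sub_add {a : ℤ} {i : ℕ} (h : a ≠ 0 ∧ lev a = i + 1) :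
    ((a - 2 ^ i ≠ 0 ∧ lev (a - 2 ^ i) = i) ∧ side (a - 2 ^ i) = false) ∧
    ((a + 2 ^ i ≠ 0 ∧ lev (a + 2 ^ i) = i) ∧ side (a + 2 ^ i) = true) := by
  obtain ⟨q, hq⟩ := (modEq_two_pow_iff.2 h).symm.dvd
  have ha : a = 2 ^ i * (4 * q + 2) := by
    have e : (2 : ℤ) ^ (i + 1 + 1) = 2 ^ i * 4 := by ring
    have e' : (2 : ℤ) ^ (i + 1) = 2 ^ i * 2 := by ring
    rw [e, e'] at hq
    linarith
  have h1 : a - 2 ^ i ≠ 0 ∧ lev (a - 2 ^ i) = i :=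
    modEq_two_pow_iff.1 (Int.modEq_comm.1 (Int.modEq_iff_dvd.2 ⟨2 * q, by rw [ha]; ring⟩))
  have h2 : a + 2 ^ i ≠ 0 ∧ lev (a + 2 ^ i) = i :=
    modEq_two_pow_iff.1 (Int.modEq_comm.1 (Int.modEq_iff_dvd.2 ⟨2 * q + 1, by rw [ha]; ring⟩))
  refine ⟨⟨h1, (side_eq_iff h1).2
    (Int.modEq_comm.1 (Int.modEq_iff_dvd.2 ⟨q, by rw [ha]; ring⟩))⟩, h2, ?_⟩
  rw [← Bool.not_eq_false, side_eq_iff h2, Int.modEq_comm, Int.modEq_iff_dvd]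
  have e : a + 2 ^ i - 2 ^ i = 2 ^ i * (4 * q + 2) := by rw [ha]; ring
  rw [e, pow_add, mul_dvd_mul_iff_left (by positivity)]
  omega

theorem robTile_rot {y z : ℤ} {i : ℕ} (hy : y ≠ 0 ∧ lev y = i) (hz : z ≠ 0 ∧ lev z = i) :
    (robTile (y, z)).rot = crossRot (side y) (side z) := by
  rw [robTile_of_mem_crossSites
    (mem_crossSites_iff.2 (.inr ⟨hy.1, hz.1, hy.2.trans hz.2.symm⟩))]

/-- For necessity in the induction step the lower left corner suffices: its rotation 0 forces its
coordinates to be `2^i` modulo `2^(i+2)`, which determines the level of the centre. -/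
theorem isSupertile_robTile_iff (i : ℕ) (y z : ℤ) :
    IsSupertile robTile i y z ↔ (y ≠ 0 ∧ lev y = i) ∧ (z ≠ 0 ∧ lev z = i) := by
  induction i generalizing y z with
  | zero =>
    simp only [IsSupertile, robTile_shape_eq_cross_iff]
    constructor
    · rintro ⟨h, ho⟩
      rw [robTile_of_mem_crossSites h] at ho
      rw [mem_crossSites_iff] at h
      rcases h with ⟨rfl, rfl⟩ | ⟨hy, hz, h⟩
      -- The cross at the origin has parity digits 0, so it is not a level-0 supertile.
      · simp at ho
      · simp only [Bool.or_eq_true, decide_eq_true_eq, ← lev_eq_zero_iff hy,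
          ← lev_eq_zero_iff hz, h, or_self] at ho
        exact ⟨⟨hy, h.trans ho⟩, hz, ho⟩
    · rintro ⟨⟨hy, h⟩, hz, h'⟩
      have hc : (y, z) ∈ crossSites := mem_crossSites_iff.2 (.inr ⟨hy, hz, h.trans h'.symm⟩)
      refine ⟨hc, ?_⟩
      rw [robTile_of_mem_crossSites hc]
      simp [(lev_eq_zero_iff hy).1 h]
  | succ i ih =>
    simp only [IsSupertile, ih]
    constructor
    · rintro ⟨-, ⟨⟨h1, h2⟩, h3⟩, -⟩
      rw [robTile_rot h1 h2, show (0 : Fin 4) = crossRot false false from rfl,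
        crossRot_eq_iff, side_eq_iff h1, side_eq_iff h2] at h3
      rw [← modEq_two_pow_iff, ← modEq_two_pow_iff]
      have e : (2 : ℤ) ^ (i + 1) = 2 ^ i + 2 ^ i := by ring
      have key : ∀ a : ℤ, a - 2 ^ i ≡ 2 ^ i [ZMOD 2 ^ (i + 2)] →
          a ≡ 2 ^ (i + 1) [ZMOD 2 ^ (i + 1 + 1)] := by
        intro a ha
        have := ha.add_right (2 ^ i)
        rwa [sub_add_cancel, ← e] at this
      exact ⟨key _ h3.1, key _ h3.2⟩
    · rintro ⟨hy, hz⟩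
      obtain ⟨⟨ly, sy⟩, ly', sy'⟩ := side_sub_add hy
      obtain ⟨⟨lz, sz⟩, lz', sz'⟩ := side_sub_add hz
      refine ⟨(robTile_shape_eq_cross_iff _).2
        (mem_crossSites_iff.2 (.inr ⟨hy.1, hz.1, hy.2.trans hz.2.symm⟩)), ⟨⟨ly, lz⟩, ?_⟩,
        ⟨⟨ly', lz⟩, ?_⟩, ⟨⟨ly', lz'⟩, ?_⟩, ⟨⟨ly, lz'⟩, ?_⟩⟩
      · rw [robTile_rot ly lz, sy, sz]; rfl
      · rw [robTile_rot ly' lz, sy', sz]; rfl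
      · rw [robTile_rot ly' lz', sy', sz']; rfl
      · rw [robTile_rot ly lz', sy, sz']; rfl

/-! ### Local rules define a shift of finite type -/

/-- Forbid every pattern on `W` that violates `P`; a finite alphabet leaves finitely many. -/
theorem isSFT_of_window {G A : Type*} [Group G] [Finite A] (W : Finset G)
    (P : (W → A) → Prop) : IsSFT {ω : G → A | ∀ g, P fun w => ω (w * g)} := by
  refine ⟨(fun v => ⟨W, v⟩) '' {v | ¬ P v}, (Set.toFinite _).image _, ?_⟩
  ext ω
  simp only [Set.mem_ofPred_eq, avoiding, Set.forall_mem_image, Pattern.OccursIn, not_exists]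
  constructor
  · intro h v hv g hg
    exact hv (by simpa only [funext hg] using h g)
  · intro h g
    by_contra hP
    exact h hP g fun _ => rfl

open Classical Heis in
/-- The displacements occurring in the local rules. -/
noncomputable def window : Finset Heis :=
  {1, gx, gy, gz, gx⁻¹, gz⁻¹, gz * gy⁻¹, gz⁻¹ * gy, gx ^ 2, gx ^ 2 * gz}

open Heis in
/-- The local rules at one site, whose surroundings show `η`. -/
structure IsValidAtOne (η : Heis → Alphabet) : Prop where
  rob_coset : IsRob (η 1) → IsRob (η gy) ∧ IsRob (η gz)
  count_coset : IsCount (η 1) → IsCount (η gy) ∧ IsCount (η gz)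
  rob_right : ∀ s t, η 1 = .inl s → η gy = .inl t → s.FitsRight t
  rob_above : ∀ s t, η 1 = .inl s → η gz = .inl t → s.FitsAbove t
  diagonal : HasDiagonal (η 1) → HasDiagonal (η (gz * gy⁻¹)) ∧ HasDiagonal (η (gz⁻¹ * gy))
  forward : HasForward (η 1) → HasForward (η gz) ∧ HasForward (η gz⁻¹)
  alternate_rob : IsRob (η 1) → IsCount (η gx)
  alternate_count : IsCount (η 1) → IsRob (η gx)
  cross_rob : IsRob (η 1) →
    (IsBold (η gx) ↔ IsCross (η 1)) ∧ (IsBold (η gx⁻¹) ↔ IsCross (η 1))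
  cross_count : IsCount (η 1) →
    (IsCross (η gx) ↔ IsBold (η 1)) ∧ (IsCross (η gx⁻¹) ↔ IsBold (η 1))
  least_bit : ∀ c r c' : Count, η 1 = .inr c → η gz = .inr r → η (gx ^ 2) = .inr c' →
    c.1.bold = false → r.1.bold = true → c'.1 ≠ c.1
  add : ∀ c r c' r' : Count, η 1 = .inr c → η gz = .inr r →
    η (gx ^ 2) = .inr c' → η (gx ^ 2 * gz) = .inr r' →
    r.1.bold = false → AddPattern c.1 r.1 c'.1 r'.1
  overflow : ∀ c c' : Count, η 1 = .inr c → η (gx ^ 2) = .inr c' → c.1.bold = true →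
    c.2 = if c.1 = ⟨true, true⟩ ∧ c'.1 = ⟨true, false⟩ then Seg.both else Seg.blank

theorem isValid_iff (ω : Heis → Alphabet) :
    IsValid ω ↔ ∀ g, IsValidAtOne fun w => ω (w * g) := by
  constructor
  · rintro ⟨h1, h2, h3, h4, h5, h6, h7, h8, h9, h10, h11, h12, h13⟩ g
    constructor <;> simp only [one_mul]
    exacts [h1 g, h2 g, h3 g, h4 g, h5 g, h6 g, h7 g, h8 g, h9 g, h10 g, h11 g, h12 g, h13 g]
  · intro h
    constructor <;> intro g <;> have hg := h g
    · simpa only [one_mul] using hg.rob_coset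
    · simpa only [one_mul] using hg.count_coset
    · simpa only [one_mul] using hg.rob_right
    · simpa only [one_mul] using hg.rob_above
    · simpa only [one_mul] using hg.diagonal
    · simpa only [one_mul] using hg.forward
    · simpa only [one_mul] using hg.alternate_rob
    · simpa only [one_mul] using hg.alternate_count
    · simpa only [one_mul] using hg.cross_rob
    · simpa only [one_mul] using hg.cross_count
    · simpa only [one_mul] using hg.least_bit
    · simpa only [one_mul] using hg.add
    · simpa only [one_mul] using hg.overflow

theorem IsValidAtOne.congr {η θ : Heis → Alphabet} (h : ∀ w ∈ window, η w = θ w)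
    (hη : IsValidAtOne η) : IsValidAtOne θ := by
  simp only [window, Finset.mem_insert, Finset.mem_singleton, forall_eq_or_imp, forall_eq] at h
  obtain ⟨e1, e2, e3, e4, e5, e6, e7, e8, e9, e10⟩ := h
  obtain ⟨h1, h2, h3, h4, h5, h6, h7, h8, h9, h10, h11, h12, h13⟩ := hη
  rw [e1, e3, e4] at h1 h2
  rw [e1, e3] at h3
  rw [e1, e4] at h4
  rw [e1, e7, e8] at h5
  rw [e1, e4, e6] at h6
  rw [e1, e2] at h7 h8
  rw [e1, e2, e5] at h9 h10
  rw [e1, e4, e9] at h11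
  rw [e1, e4, e9, e10] at h12
  rw [e1, e9] at h13
  exact ⟨h1, h2, h3, h4, h5, h6, h7, h8, h9, h10, h11, h12, h13⟩

theorem isSFT_Omega : IsSFT Omega := by
  -- A window pattern is admitted if some extension satisfies the rules; by `IsValidAtOne.congr` the
  -- choice of extension is irrelevant.
  convert isSFT_of_window window (fun v : window → Alphabet => ∃ η : Heis → Alphabet,
    (∀ w : window, η w = v w) ∧ IsValidAtOne η) using 1
  ext ω
  rw [Omega, Set.mem_ofPred_eq, isValid_iff]
  refine forall_congr' fun g => ⟨fun h => ⟨_, fun _ => rfl, h⟩, ?_⟩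
  rintro ⟨η, hη, h⟩
  exact h.congr fun w hw => hη ⟨w, hw⟩

/-! ### Binary counters -/

/-- Bit `n` drops from 1 to 0 exactly when the bits `0, …, n` of `k` are all 1. -/
theorem bit_overflow_iff {n : ℕ} {k : ℤ} :
    bit n k = true ∧ bit n (k + 1) = false ↔ (2 : ℤ) ^ (n + 1) ∣ k + 1 := by
  rw [two_pow_succ_dvd_iff_bit]
  by_cases h : (2 : ℤ) ^ n ∣ k + 1
  · have := bit_sub_one_of_dvd h
    rw [add_sub_cancel_right] at this
    simp [h, this]
  · have := bit_sub_one_of_not_dvd h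
    rw [add_sub_cancel_right] at this
    simp [h, this]

theorem bit_succ_add_one (n : ℕ) (k : ℤ) :
    bit (n + 1) (k + 1) = xor (bit (n + 1) k) (bit n k && !bit n (k + 1)) := by
  have key := bit_overflow_iff (n := n) (k := k)
  by_cases h : (2 : ℤ) ^ (n + 1) ∣ k + 1
  · have := bit_sub_one_of_dvd h
    rw [add_sub_cancel_right] at this
    obtain ⟨h1, h2⟩ := key.2 h
    simp [this, h1, h2]
  · have := bit_sub_one_of_not_dvd h
    rw [add_sub_cancel_right] at this
    have h3 : (bit n k && !bit n (k + 1)) = false := by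
      rw [← Bool.not_eq_true]
      simpa [h] using key
    rw [this, h3, Bool.xor_false]

theorem bit_zero_add_one (k : ℤ) : bit 0 (k + 1) = !bit 0 k := by
  have := bit_sub_one_of_dvd (n := 0) (b := k + 1) (by simp)
  rw [add_sub_cancel_right] at this
  simp [this]

theorem bit_eq_true_of_dvd {n N : ℕ} {k : ℤ} (hn : n < N) (h : (2 : ℤ) ^ N ∣ k + 1) :
    bit n k = true :=
  (bit_overflow_iff.2 ((pow_dvd_pow 2 hn).trans h)).1

theorem bit_natCast_zero (n : ℕ) : bit n 0 = false := by simp [bit]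

theorem sum_bit_mul_two_pow (k : ℤ) (n : ℕ) :
    ∑ t ∈ Finset.range n, (if bit t k then 1 else 0) * (2 : ℤ) ^ t = k % 2 ^ n := by
  induction n with
  | zero => simp
  | succ n ih =>
    rw [Finset.sum_range_succ, ih]
    have h1 := Int.emod_add_mul_ediv k (2 ^ n)
    have h2 := Int.emod_add_mul_ediv k (2 ^ (n + 1))
    rw [ediv_two_pow_succ] at h2
    have h3 := Int.emod_add_mul_ediv (k / 2 ^ n) 2
    have h4 : (if bit n k then 1 else 0 : ℤ) = k / 2 ^ n % 2 := by
      simp only [bit, decide_eq_true_eq]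
      split_ifs <;> omega
    rw [h4]
    linear_combination h1 - h2 + (2 : ℤ) ^ n * h3

/-! ### Bold sites under the shear -/

theorem mem_boldSites_zero {z : ℤ} : (0, z) ∈ boldSites ↔ z = 0 := by
  simp [boldSites, modEq_two_pow_iff]

theorem mem_boldSites {y z : ℤ} (hy : y ≠ 0) :
    (y, z) ∈ boldSites ↔ (2 : ℤ) ^ (lev y + 1) ∣ z := by
  simp [boldSites, modEq_two_pow_iff, hy, Int.modEq_zero_iff_dvd]

theorem two_pow_lev_succ_dvd_two_mul (y : ℤ) : (2 : ℤ) ^ (lev y + 1) ∣ 2 * y := by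
  rcases eq_or_ne y 0 with rfl | hy
  · simp
  · rw [pow_succ']; exact mul_dvd_mul_left 2 (lev_spec hy).1

theorem mem_boldSites_add_two_mul {y z : ℤ} :
    (y, z + 2 * y) ∈ boldSites ↔ (y, z) ∈ boldSites := by
  rcases eq_or_ne y 0 with rfl | hy
  · simp
  · rw [mem_boldSites hy, mem_boldSites hy, Int.dvd_add_left (two_pow_lev_succ_dvd_two_mul y)]

/-- As `y ≡ 2^i` modulo `2^(i+1)` for `i = lev y`, adding `y` exchanges the classes of `2^i` and
`0`. -/
theorem add_mem_boldSites_iff {y z : ℤ} : (y, z + y) ∈ boldSites ↔ (y, z) ∈ crossSites := by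
  rcases eq_or_ne y 0 with rfl | hy
  · rw [add_zero, mem_boldSites_zero, mem_crossSites_iff]; simp
  · have h := modEq_two_pow_iff.2 ⟨hy, rfl⟩
    have e : z + y = z - 2 ^ lev y + (2 ^ (lev y + 1) - (2 ^ lev y - y)) := by ring
    rw [mem_boldSites hy, mem_crossSites_iff, e,
      Int.dvd_add_left (dvd_sub dvd_rfl h.dvd), ← Int.modEq_iff_dvd, Int.modEq_comm,
      modEq_two_pow_iff]
    simp [hy, eq_comm]

theorem sub_mem_boldSites_iff {y z : ℤ} : (y, z - y) ∈ boldSites ↔ (y, z) ∈ crossSites := by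
  rw [← add_mem_boldSites_iff, ← mem_boldSites_add_two_mul]
  ring_nf

/-- The digit in column `y`, at height `z`, of the counters with value `k`. -/
noncomputable def counterBit (k y z : ℤ) : Bool :=
  if y = 0 then if z < 0 then bit (-1 - z).toNat k else decide (k < 0)
  else bit (2 ^ (lev y + 1) - 1 - (z % 2 ^ (lev y + 1)).toNat) k

/-- The counters of column `y` with value `k` are about to overflow. -/
def Overflows (k y : ℤ) : Prop :=
  if y = 0 then k = -1 else (2 : ℤ) ^ 2 ^ (lev y + 1) ∣ k + 1

theorem overflows_iff {k y : ℤ} : Overflows k y ↔ (k = -1 ∧ y = 0) ∨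
    ∃ i : ℕ, 1 ≤ i ∧ 2 ^ 2 ^ i ∣ k + 1 ∧ y ≡ 2 ^ (i - 1) [ZMOD 2 ^ i] := by
  have h : (∃ i : ℕ, 1 ≤ i ∧ 2 ^ 2 ^ i ∣ k + 1 ∧ y ≡ 2 ^ (i - 1) [ZMOD 2 ^ i]) ↔
      y ≠ 0 ∧ (2 : ℤ) ^ 2 ^ (lev y + 1) ∣ k + 1 := by
    constructor
    · rintro ⟨_ | i, h1, h2, h3⟩
      · omega
      · obtain ⟨hy, rfl⟩ := modEq_two_pow_iff.1 h3
        exact ⟨hy, h2⟩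
    · rintro ⟨hy, h⟩
      exact ⟨lev y + 1, by omega, h, modEq_two_pow_iff.2 ⟨hy, rfl⟩⟩
  rw [h, Overflows]
  split_ifs with hy <;> simp [hy]

theorem lev_add_of_dvd {y z : ℤ} (hy : y ≠ 0) (h : (2 : ℤ) ^ (lev y + 1) ∣ z) :
    y + z ≠ 0 ∧ lev (y + z) = lev y := by
  rw [← modEq_two_pow_iff]
  simpa using (modEq_two_pow_iff.2 ⟨hy, rfl⟩).add (Int.modEq_zero_iff_dvd.2 h)

theorem overflows_add_of_mem_boldSites {k y z : ℤ} (h : (y, z) ∈ boldSites) :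
    Overflows k (y + z) ↔ Overflows k y := by
  rcases eq_or_ne y 0 with rfl | hy
  · rw [mem_boldSites_zero] at h; simp [h]
  · obtain ⟨h1, h2⟩ := lev_add_of_dvd hy ((mem_boldSites hy).1 h)
    simp [Overflows, hy, h1, h2]

theorem overflows_neg_one (y : ℤ) : Overflows (-1) y := by simp [Overflows]

theorem not_overflows_zero (y : ℤ) : ¬ Overflows 0 y := by
  unfold Overflows
  split_ifs
  · decide
  · intro h
    have := Int.le_of_dvd (by decide) ((dvd_pow_self 2 (by positivity)).trans h)
    omega

theorem counterBit_eq_true_of_overflows {k y : ℤ} (h : Overflows k y) (z : ℤ) :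
    counterBit k y z = true := by
  unfold Overflows at h
  unfold counterBit
  split_ifs at h ⊢ with hy hz
  · exact bit_eq_true_of_dvd (Nat.lt_succ_self _) (by simp [h])
  · simp [h]
  · refine bit_eq_true_of_dvd ?_ h
    have : 0 < 2 ^ (lev y + 1) := by positivity
    omega

theorem counterBit_zero (y z : ℤ) : counterBit 0 y z = false := by
  unfold counterBit
  split_ifs <;> simp [bit_natCast_zero]

theorem counterBit_add_two_mul (k y z : ℤ) : counterBit k y (z + 2 * y) = counterBit k y z := by
  rcases eq_or_ne y 0 with rfl | hy
  · simp
  · simp [counterBit, hy, Int.add_emod, Int.emod_eq_zero_of_dvd (two_pow_lev_succ_dvd_two_mul y)]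

/-- Just below a bold site stands the least significant digit of a counter; in column 0 this is the
site `z = -1`. -/
theorem counterBit_add_one_of_mem_boldSites {k y z : ℤ} (h : (y, z + 1) ∈ boldSites) :
    counterBit (k + 1) y z = !counterBit k y z := by
  rcases eq_or_ne y 0 with rfl | hy
  · rw [mem_boldSites_zero] at h
    obtain rfl : z = -1 := by omega
    simp [counterBit, bit_zero_add_one]
  · rw [mem_boldSites hy] at h
    have hp : (0 : ℤ) < 2 ^ (lev y + 1) := by positivity
    obtain ⟨q, hq⟩ := h
    have hz : z % 2 ^ (lev y + 1) = 2 ^ (lev y + 1) - 1 :=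
      ((Int.ediv_emod_unique (q := q - 1) hp).2 ⟨by linear_combination -hq, by omega, by omega⟩).2
    have h0 : 2 ^ (lev y + 1) - 1 - (z % 2 ^ (lev y + 1)).toNat = 0 := by
      rw [hz]
      have : ((2 ^ (lev y + 1) : ℕ) : ℤ) = 2 ^ (lev y + 1) := by push_cast; rfl
      omega
    simp only [counterBit, hy, if_false, h0, bit_zero_add_one]

/-- One step down within a counter raises the index of the bit by one, so this is the carry rule.
The upper half of column 0 has no least significant digit: its digits are all equal and drop
together at `k = -1`, as if a carry came from infinity. -/
theorem counterBit_add_one_of_notMem_boldSites {k y z : ℤ} (h : (y, z + 1) ∉ boldSites) :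
    counterBit (k + 1) y z =
      xor (counterBit k y z) (counterBit k y (z + 1) && !counterBit (k + 1) y (z + 1)) := by
  rcases eq_or_ne y 0 with rfl | hy
  · rw [mem_boldSites_zero] at h
    rcases lt_or_ge z 0 with hz | hz
    · have hz' : z + 1 < 0 := by omega
      have e : (-1 - z).toNat = (-1 - (z + 1)).toNat + 1 := by omega
      simp only [counterBit, if_true, hz, hz', e]
      exact bit_succ_add_one _ _
    · have hz' : ¬ z + 1 < 0 := by omega
      simp only [counterBit, if_true, hz.not_gt, hz', if_false]
      by_cases h1 : k < 0 <;> by_cases h2 : k + 1 < 0 <;> simp [h1, h2]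
      omega
  · rw [mem_boldSites hy] at h
    have hp : (0 : ℤ) < 2 ^ (lev y + 1) := by positivity
    have hz : (z + 1) % 2 ^ (lev y + 1) = z % 2 ^ (lev y + 1) + 1 := by
      have h1 := Int.emod_nonneg (z + 1) hp.ne'
      have h2 := Int.emod_lt_of_pos (z + 1) hp
      have h3 := Int.emod_add_mul_ediv (z + 1) (2 ^ (lev y + 1))
      have h4 : (z + 1) % 2 ^ (lev y + 1) ≠ 0 := fun h' => h (Int.dvd_of_emod_eq_zero h')
      have := ((Int.ediv_emod_unique (a := z) (q := (z + 1) / 2 ^ (lev y + 1))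
        (r := (z + 1) % 2 ^ (lev y + 1) - 1) hp).2 ⟨by linear_combination h3, by omega, by omega⟩).2
      omega
    have e : 2 ^ (lev y + 1) - 1 - (z % 2 ^ (lev y + 1)).toNat =
        2 ^ (lev y + 1) - 1 - ((z + 1) % 2 ^ (lev y + 1)).toNat + 1 := by
      have : ((2 ^ (lev y + 1) : ℕ) : ℤ) = 2 ^ (lev y + 1) := by push_cast; rfl
      have h1 := Int.emod_nonneg z hp.ne'
      have h2 := Int.emod_lt_of_pos (z + 1) hp
      omega
    simp only [counterBit, hy, if_false, e]
    exact bit_succ_add_one _ _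

/-- For `y ≠ 0` the bold digit is the most significant one of its counter, and it drops from 1 to 0
only when the whole counter overflows. -/
theorem overflows_iff_counterBit {k y z : ℤ} (h : (y, z) ∈ boldSites) :
    counterBit k y z = true ∧ counterBit (k + 1) y z = false ↔ Overflows k y := by
  rcases eq_or_ne y 0 with rfl | hy
  · rw [mem_boldSites_zero] at h
    subst h
    simp only [counterBit, Overflows, if_true, lt_irrefl, if_false, decide_eq_true_eq,
      decide_eq_false_iff_not]
    omega
  · rw [mem_boldSites hy] at h
    have h1 : 2 ^ (lev y + 1) - 1 + 1 = 2 ^ (lev y + 1) := Nat.sub_add_cancel Nat.one_le_two_pow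
    simp only [counterBit, Overflows, hy, if_false, Int.emod_eq_zero_of_dvd h, Int.toNat_zero,
      Nat.sub_zero, bit_overflow_iff, h1]

/-! ### The configuration and its local rules -/

open Classical in
/-- The counter symbol at `(2 k + 1, (y, z))`. -/
noncomputable def counterSymbol (k y z : ℤ) : Count :=
  (⟨decide ((y, z) ∈ boldSites), counterBit k y z⟩,
    ⟨decide (Overflows k (y + z)), decide (Overflows k y)⟩)

/-- Copies of the hierarchical Robinson tiling alternating with layers of counters. -/
noncomputable def config (h : Heis) : Alphabet :=
  if h.x % 2 = 0 then .inl (robTile (h.y, h.z)) else .inr (counterSymbol (h.x / 2) h.y h.z)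

theorem config_even (k y z : ℤ) : config ⟨2 * k, y, z⟩ = .inl (robTile (y, z)) := by
  simp [config]

theorem config_odd (k y z : ℤ) : config ⟨2 * k + 1, y, z⟩ = .inr (counterSymbol k y z) := by
  have h1 : (2 * k + 1) % 2 ≠ 0 := by omega
  have h2 : (2 * k + 1) / 2 = k := by omega
  simp only [config, h1, h2, if_false]

theorem gy_mul (x y z : ℤ) : Heis.gy * ⟨x, y, z⟩ = ⟨x, y + 1, z⟩ := by
  ext <;> simp [Heis.gy, add_comm]

theorem gz_mul (x y z : ℤ) : Heis.gz * ⟨x, y, z⟩ = ⟨x, y, z + 1⟩ := by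
  ext <;> simp [Heis.gz, add_comm]

theorem gz_inv_mul (x y z : ℤ) : Heis.gz⁻¹ * ⟨x, y, z⟩ = ⟨x, y, z - 1⟩ := by
  ext <;> simp [Heis.gz, sub_eq_add_neg, add_comm]

theorem gz_mul_gy_inv_mul (x y z : ℤ) : Heis.gz * Heis.gy⁻¹ * ⟨x, y, z⟩ = ⟨x, y - 1, z + 1⟩ := by
  ext <;> simp [Heis.gz, Heis.gy, sub_eq_add_neg, add_comm]

theorem gz_inv_mul_gy_mul (x y z : ℤ) : Heis.gz⁻¹ * Heis.gy * ⟨x, y, z⟩ = ⟨x, y + 1, z - 1⟩ := by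
  ext <;> simp [Heis.gz, Heis.gy, sub_eq_add_neg, add_comm]

theorem gx_mul_even (k y z : ℤ) : Heis.gx * ⟨2 * k, y, z⟩ = ⟨2 * k + 1, y, z + y⟩ := by
  ext <;> simp [Heis.gx, add_comm]

theorem gx_mul_odd (k y z : ℤ) : Heis.gx * ⟨2 * k + 1, y, z⟩ = ⟨2 * (k + 1), y, z + y⟩ := by
  ext <;> simp [Heis.gx]; ring

theorem gx_inv_mul_even (k y z : ℤ) :
    Heis.gx⁻¹ * ⟨2 * k, y, z⟩ = ⟨2 * (k - 1) + 1, y, z - y⟩ := by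
  ext <;> simp [Heis.gx] <;> ring

theorem gx_inv_mul_odd (k y z : ℤ) : Heis.gx⁻¹ * ⟨2 * k + 1, y, z⟩ = ⟨2 * k, y, z - y⟩ := by
  ext <;> simp [Heis.gx]; ring

theorem gx_sq_mul_odd (k y z : ℤ) :
    Heis.gx ^ 2 * ⟨2 * k + 1, y, z⟩ = ⟨2 * (k + 1) + 1, y, z + 2 * y⟩ := by
  rw [pow_two, mul_assoc]
  ext <;> simp [Heis.gx] <;> ring

theorem gz_pow_mul (t : ℕ) (x y z : ℤ) : Heis.gz ^ t * ⟨x, y, z⟩ = ⟨x, y, z + t⟩ := by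
  induction t with
  | zero => simp
  | succ t ih =>
    rw [pow_succ', mul_assoc, ih, gz_mul]
    push_cast
    rw [add_assoc]

theorem Heis.forall_iff {P : Heis → Prop} :
    (∀ h, P h) ↔ (∀ k y z : ℤ, P ⟨2 * k, y, z⟩) ∧ (∀ k y z : ℤ, P ⟨2 * k + 1, y, z⟩) := by
  refine ⟨fun h => ⟨fun _ _ _ => h _, fun _ _ _ => h _⟩, ?_⟩
  rintro ⟨h0, h1⟩ ⟨x, y, z⟩
  rcases Int.even_or_odd' x with ⟨k, rfl | rfl⟩
  · exact h0 _ _ _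
  · exact h1 _ _ _

theorem config_mem : config ∈ Omega := by
  classical
  -- After splitting by the parity of `x` and evaluating the translates, nine goals survive: two
  -- Robinson rules, two segment rules, two cross rules, and the three counter rules.
  constructor <;> rw [Heis.forall_iff] <;> refine ⟨fun k y z => ?_, fun k y z => ?_⟩ <;>
    simp only [gy_mul, gz_mul, gz_inv_mul, gz_mul_gy_inv_mul, gz_inv_mul_gy_mul, gx_mul_even,
      gx_mul_odd, gx_inv_mul_even, gx_inv_mul_odd, gx_sq_mul_odd, mul_assoc (Heis.gx ^ 2),
      config_even, config_odd, IsRob, IsCount, IsCross, IsBold, HasDiagonal, HasForward,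
      counterSymbol, true_imp_iff, false_imp_iff, and_self, reduceCtorEq, decide_eq_true_eq,
      implies_true, Sum.inl.injEq, Sum.inr.injEq]
  · rintro s t rfl rfl
    exact (robTile_mem y z).1
  · rintro s t rfl rfl
    exact (robTile_mem y z).2
  · intro h
    constructor
    · rwa [show y - 1 + (z + 1) = y + z by ring]
    · rwa [show y + 1 + (z - 1) = y + z by ring]
  · exact id
  · rw [add_mem_boldSites_iff, sub_mem_boldSites_iff, robTile_shape_eq_cross_iff]; simp
  · rw [robTile_shape_eq_cross_iff, robTile_shape_eq_cross_iff, ← sub_mem_boldSites_iff,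
      ← add_mem_boldSites_iff]; simp
  -- The shear by `2y` does not change the digits of the column, so the digit below the bold one is
  -- simply flipped.
  · rintro c r c' rfl rfl rfl h1 h2 h3
    rw [decide_eq_true_eq] at h2
    have h4 := congrArg Bin.bit h3
    simp only [counterBit_add_two_mul, counterBit_add_one_of_mem_boldSites h2] at h4
    simp at h4
  · rintro c r c' r' rfl rfl rfl rfl h
    rw [decide_eq_false_iff_not] at h
    rw [show z + 1 + 2 * y = z + 2 * y + 1 by ring]
    have h' : (y, z + 2 * y + 1) ∉ boldSites := by
      rwa [show z + 2 * y + 1 = z + 1 + 2 * y by ring, mem_boldSites_add_two_mul]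
    refine ⟨by simpa using h, by simpa using h', ?_, ?_⟩
    · simp [mem_boldSites_add_two_mul]
    · simp only [counterBit_add_two_mul]
      rw [show z + 2 * y + 1 = z + 1 + 2 * y by ring, counterBit_add_two_mul]
      exact counterBit_add_one_of_notMem_boldSites h
  · rintro c c' rfl rfl h
    rw [decide_eq_true_eq] at h
    have := overflows_iff_counterBit (k := k) h
    simp only [overflows_add_of_mem_boldSites h, counterBit_add_two_mul, h, decide_true,
      Bin.mk.injEq, true_and, mem_boldSites_add_two_mul, this]
    by_cases ho : Overflows k y <;> simp [ho, Seg.both, Seg.blank]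

/-! ### Reading off the counters -/

theorem digit_config_odd (k y z : ℤ) :
    digit (config ⟨2 * k + 1, y, z⟩) = if counterBit k y z then 1 else 0 := by
  rw [config_odd]; rfl

theorem counterValue_config {i : ℕ} {k y z : ℤ} (hi : 1 ≤ i)
    (hy : y ≡ 2 ^ (i - 1) [ZMOD 2 ^ i]) (hz : z ≡ 0 [ZMOD 2 ^ i]) :
    counterValue config (2 ^ i) ⟨2 * k + 1, y, z⟩ = k % 2 ^ 2 ^ i := by
  obtain ⟨i, rfl⟩ : ∃ j, i = j + 1 := ⟨i - 1, by omega⟩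
  obtain ⟨hy, rfl⟩ := modEq_two_pow_iff.1 hy
  -- The counter is read from the most significant digit, hence the reversal of the summation index.
  rw [counterValue, ← sum_bit_mul_two_pow,
    ← Finset.sum_range_reflect fun t => (if bit t k then 1 else 0) * (2 : ℤ) ^ t]
  refine Finset.sum_congr rfl fun t ht => ?_
  rw [Finset.mem_range] at ht
  have h : (z + t) % 2 ^ (lev y + 1) = t := by
    have e : (z + t) % 2 ^ (lev y + 1) = (0 + t) % 2 ^ (lev y + 1) := hz.add_right _
    rw [e, zero_add]
    exact Int.emod_eq_of_lt (by positivity) (by exact_mod_cast ht)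
  rw [gz_pow_mul, digit_config_odd, counterBit, if_neg ‹y ≠ 0›, h, Int.toNat_natCast]

theorem digit_config_neg (k : ℤ) (n : ℕ) :
    digit (config ⟨2 * k + 1, 0, -1 - n⟩) = k / 2 ^ n % 2 := by
  have h1 : (-1 - (n : ℤ)) < 0 := by omega
  have h2 : (-1 - (-1 - (n : ℤ))).toNat = n := by omega
  rw [digit_config_odd, counterBit, if_pos rfl, if_pos h1, h2, bit]
  simp only [decide_eq_true_eq]
  split_ifs <;> omega

theorem digit_config_nonneg (k : ℤ) (n : ℕ) :
    digit (config ⟨2 * k + 1, 0, n⟩) = if k < 0 then 1 else 0 := by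
  have h1 : ¬ (n : ℤ) < 0 := by omega
  rw [digit_config_odd, counterBit, if_pos rfl, if_neg h1]
  simp

end HeisSFT

theorem proposition4p7 :
    HeisSFT.IsSFT HeisSFT.Omega ∧ HeisSFT.Omega.Nonempty ∧
    ∃ ρ ∈ HeisSFT.OmegaRob,
      -- the level-`i` supertiles of `ρ` are centred at `(2ⁱ + 2ⁱ⁺¹ℤ) × (2ⁱ + 2ⁱ⁺¹ℤ)`
      (∀ (i : ℕ) (y z : ℤ), HeisSFT.IsSupertile ρ i y z ↔
        y ≡ 2 ^ i [ZMOD 2 ^ (i + 1)] ∧ z ≡ 2 ^ i [ZMOD 2 ^ (i + 1)]) ∧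
      (∀ p : ℤ × ℤ, (ρ p).shape = HeisSFT.Shape.cross ↔ p ∈ HeisSFT.crossSites) ∧
      ∃ ω ∈ HeisSFT.Omega,
        -- copies of `ρ` on the even cosets
        (∀ k y z : ℤ, ω ⟨2 * k, y, z⟩ = Sum.inl (ρ (y, z))) ∧
        -- counter symbols, with the prescribed bold digits and segments, on the odd cosets
        (∀ k y z : ℤ, ∃ (b : HeisSFT.Bin) (s : HeisSFT.Seg),
          ω ⟨2 * k + 1, y, z⟩ = Sum.inr (b, s) ∧
          (b.bold = true ↔ (y, z) ∈ HeisSFT.boldSites) ∧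
          (s.forward = true ↔ (k = -1 ∧ y = 0) ∨
            ∃ i : ℕ, 1 ≤ i ∧ 2 ^ 2 ^ i ∣ k + 1 ∧ y ≡ 2 ^ (i - 1) [ZMOD 2 ^ i]) ∧
          (s.diagonal = true ↔ (k = -1 ∧ y + z = 0) ∨
            ∃ i : ℕ, 1 ≤ i ∧ 2 ^ 2 ^ i ∣ k + 1 ∧ y + z ≡ 2 ^ (i - 1) [ZMOD 2 ^ i]) ∧
          -- the digit `0` never carries a forward segment
          (s.forward = true → b.bit = true)) ∧
        -- all counters of width `2ⁱ` on the coset `2 k + 1` have the value `k mod 2 ^ 2ⁱ`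
        (∀ (i : ℕ) (k y z : ℤ), 1 ≤ i → y ≡ 2 ^ (i - 1) [ZMOD 2 ^ i] → z ≡ 0 [ZMOD 2 ^ i] →
          HeisSFT.counterValue ω (2 ^ i) ⟨2 * k + 1, y, z⟩ = k % 2 ^ 2 ^ i) ∧
        -- the two counters of infinite width, in the column `y = 0`, have the value `k`
        (∀ (k : ℤ) (n : ℕ), HeisSFT.digit (ω ⟨2 * k + 1, 0, -1 - n⟩) = k / 2 ^ n % 2) ∧
        (∀ (k : ℤ) (n : ℕ), HeisSFT.digit (ω ⟨2 * k + 1, 0, n⟩) = if k < 0 then 1 else 0) ∧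
        -- all counters overflow from the coset `-1` to the coset `1`
        (∀ y z : ℤ, ∃ e : Bool, (e = true ↔ (y, z) ∈ HeisSFT.boldSites) ∧
          ω ⟨-1, y, z⟩ = Sum.inr (⟨e, true⟩, HeisSFT.Seg.both) ∧
          ω ⟨1, y, z⟩ = Sum.inr (⟨e, false⟩, HeisSFT.Seg.blank)) := by
  classical
  refine ⟨HeisSFT.isSFT_Omega, ⟨_, HeisSFT.config_mem⟩, HeisSFT.robTile, HeisSFT.robTile_mem,
    fun i y z => ?_, HeisSFT.robTile_shape_eq_cross_iff, HeisSFT.config, HeisSFT.config_mem,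
    HeisSFT.config_even, fun k y z => ⟨_, _, HeisSFT.config_odd k y z, ?_, ?_, ?_, ?_⟩,
    fun i k y z => HeisSFT.counterValue_config, HeisSFT.digit_config_neg,
    HeisSFT.digit_config_nonneg, fun y z => ?_⟩
  · rw [HeisSFT.isSupertile_robTile_iff, HeisSFT.modEq_two_pow_iff, HeisSFT.modEq_two_pow_iff]
  · exact decide_eq_true_iff
  · rw [← HeisSFT.overflows_iff]
    exact decide_eq_true_iff
  · rw [← HeisSFT.overflows_iff]
    exact decide_eq_true_iff
  · exact fun h => HeisSFT.counterBit_eq_true_of_overflows (of_decide_eq_true h) z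
  · refine ⟨decide ((y, z) ∈ HeisSFT.boldSites), decide_eq_true_iff, ?_, ?_⟩
    -- The layers `x = -1` and `x = 1` belong to `k = -1` and `k = 0`.
    · refine (HeisSFT.config_odd (-1) y z).trans ?_
      simp [HeisSFT.counterSymbol, HeisSFT.overflows_neg_one, HeisSFT.Seg.both,
        HeisSFT.counterBit_eq_true_of_overflows (HeisSFT.overflows_neg_one y)]
    · refine (HeisSFT.config_odd 0 y z).trans ?_
      simp [HeisSFT.counterSymbol, HeisSFT.not_overflows_zero, HeisSFT.Seg.blank,
        HeisSFT.counterBit_zero]
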